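/- **Corollary 1.** A communicating timed automaton (CTA) consists of finitely many timed automata $A_1,\dots,A_n$ over discrete time $\mathbb N$, a finite message alphabet $\Sigma$, a finite set of unbounded perfect FIFO channels $c_{i,j}$ (at most one from $A_i$ to $A_j$ for each pair $(i,j)$), a finite set of local clocks for each automaton, which only this automaton can test and reset, and a finite set of global clocks, which every automaton can test and reset. Each $A_i$ has finitely many locations, one of them initial, and finitely many transitions. A transition of $A_i$ leads from a location to a location, has a guard (a finite conjunction of constraints $x\bowtie k$ with $k\in\mathbb N$ and ${\bowtie}\in\{<,\le,=,>,\ge\}$, where $x$ is a local clock of $A_i$ or a global clock) and a set of such clocks that it resets to $0$, and performs one of three operations: nothing; appending a message $a\in\Sigma$ with age $0$ to the tail of a channel $c_{i,j}$; removing the message $a\in\Sigma$ from the head of a channel $c_{j,i}$, provided that $a$ is at the head and its age lies in a given interval (open, closed or half-open) with lower end in $\mathbb N$ and upper end in $\mathbb N\cup\{\infty\}$. At each step, either one automaton performs an enabled transition, or some time $t\in\mathbb N$ passes, which increases all clocks and the ages of all messages in the channels by $t$. A run starts with all automata in their initial locations, all clocks equal to $0$ and all channels empty. The reachability problem asks,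 given a CTA, one of its automata $A_i$ and a location $\ell$ of $A_i$, whether there is a run to a configuration in which $A_i$ is at $\ell$. The reachability problem is undecidable for CTA that consist of two timed automata $A_1, A_2$, have exactly one channel, which goes from $A_1$ to $A_2$, and have exactly one global clock (besides the local clocks of $A_1$ and of $A_2$). -/

import Mathlib

namespace CommTA

/-! Syntax.  All syntactic objects are finite data over the natural numbers, so that they can be
given to an algorithm: the locations of an automaton are `0, …, numLocs - 1`, its local clocks are
`0, …, numClocks - 1`, the global clocks of a network are `0, …, numGlobals - 1`, the messages are
`0, …, numMsgs - 1`, and finite sets are given by lists of their elements. -/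

/-- The comparison symbols of clock constraints. -/
inductive Rel where
  | lt | le | eq | gt | ge

/-- `r.Holds v k` is the relation `v ⋈ k`. -/
def Rel.Holds : Rel → ℕ → ℕ → Prop
  | .lt, v, k => v < k
  | .le, v, k => v ≤ k
  | .eq, v, k => v = k
  | .gt, v, k => v > k
  | .ge, v, k => v ≥ k

/-- A clock as named inside an automaton: `priv x` is the local clock number `x` of this automaton,
`glob x` is the global clock number `x` of the network. -/
inductive Clock where
  | priv (x : ℕ)
  | glob (x : ℕ)
  deriving DecidableEq

/-- An atomic clock constraint `clock ⋈ bound`. -/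
structure Atom where
  clock : Clock
  rel : Rel
  bound : ℕ

/-- A clock constraint: the conjunction of the listed atoms. -/
abbrev Guard : Type := List Atom

/-- `ν ⊨ g`. -/
def Guard.Sat (g : Guard) (ν : Clock → ℕ) : Prop :=
  ∀ c ∈ g, c.rel.Holds (ν c.clock) c.bound

/-- An interval with left end `lo` and right end `hi` (`none` stands for `∞`); the flags say whether
the end points belong to the interval. -/
structure AgeInterval where
  loClosed : Bool
  lo : ℕ
  hi : Option ℕ
  hiClosed : Bool

/-- `t ∈ I`. -/
def AgeInterval.Mem (I : AgeInterval) (t : ℕ) : Prop :=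
  (I.lo < t ∨ I.loClosed = true ∧ I.lo = t) ∧
    ∀ u : ℕ, I.hi = some u → (t < u ∨ I.hiClosed = true ∧ t = u)

/-- Channel operations of the automaton number `i`: `nop`; `write j a` is `c_{i,j}!a`;
`read j a I` is `c_{j,i}?(a ∈ I)`. -/
inductive ChanOp where
  | nop
  | write (j a : ℕ)
  | read (j a : ℕ) (I : AgeInterval)

/-- A transition `(src, guard, op, resets, tgt)`. -/
structure Edge where
  src : ℕ
  guard : Guard
  op : ChanOp
  resets : List Clock
  tgt : ℕ

/-- A timed automaton with channel operations as actions. -/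
structure TA where
  numLocs : ℕ
  init : List ℕ
  numClocks : ℕ
  edges : List Edge
  final : List ℕ

/-- A communicating timed automaton: a tuple of timed automata, a number of global clocks, a channel
alphabet, and a directed graph of channels; `(i, j) ∈ channels` means that there is a channel
`c_{i,j}` from the automaton number `i` to the automaton number `j` (numbering starts at `0`). -/
structure CTA where
  automata : List TA
  numGlobals : ℕ
  numMsgs : ℕ
  channels : List (ℕ × ℕ)

/-! Encoding of the syntax, as iterated products, sums and lists. -/

def Rel.equivFin : Rel ≃ Fin 5 where
  toFun
    | .lt => 0
    | .le => 1
    | .eq => 2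
    | .gt => 3
    | .ge => 4
  invFun
    | 0 => .lt
    | 1 => .le
    | 2 => .eq
    | 3 => .gt
    | 4 => .ge
  left_inv r := by cases r <;> rfl
  right_inv k := by fin_cases k <;> rfl

instance : Primcodable Rel := Primcodable.ofEquiv _ Rel.equivFin

def Clock.equivSum : Clock ≃ ℕ ⊕ ℕ where
  toFun
    | .priv x => .inl x
    | .glob x => .inr x
  invFun
    | .inl x => .priv x
    | .inr x => .glob x
  left_inv c := by cases c <;> rfl
  right_inv s := by cases s <;> rfl

instance : Primcodable Clock := Primcodable.ofEquiv _ Clock.equivSum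

def Atom.equivProd : Atom ≃ Clock × Rel × ℕ where
  toFun c := (c.clock, c.rel, c.bound)
  invFun p := ⟨p.1, p.2.1, p.2.2⟩
  left_inv _ := rfl
  right_inv _ := rfl

instance : Primcodable Atom := Primcodable.ofEquiv _ Atom.equivProd

def AgeInterval.equivProd : AgeInterval ≃ Bool × ℕ × Option ℕ × Bool where
  toFun I := (I.loClosed, I.lo, I.hi, I.hiClosed)
  invFun p := ⟨p.1, p.2.1, p.2.2.1, p.2.2.2⟩
  left_inv _ := rfl
  right_inv _ := rfl

instance : Primcodable AgeInterval := Primcodable.ofEquiv _ AgeInterval.equivProd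

def ChanOp.equivSum : ChanOp ≃ Unit ⊕ (ℕ × ℕ) ⊕ (ℕ × ℕ × AgeInterval) where
  toFun
    | .nop => .inl ()
    | .write j a => .inr (.inl (j, a))
    | .read j a I => .inr (.inr (j, a, I))
  invFun
    | .inl _ => .nop
    | .inr (.inl p) => .write p.1 p.2
    | .inr (.inr p) => .read p.1 p.2.1 p.2.2
  left_inv o := by cases o <;> rfl
  right_inv s := by rcases s with _ | _ | _ <;> rfl

instance : Primcodable ChanOp := Primcodable.ofEquiv _ ChanOp.equivSum

def Edge.equivProd : Edge ≃ ℕ × Guard × ChanOp × List Clock × ℕ where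
  toFun e := (e.src, e.guard, e.op, e.resets, e.tgt)
  invFun p := ⟨p.1, p.2.1, p.2.2.1, p.2.2.2.1, p.2.2.2.2⟩
  left_inv _ := rfl
  right_inv _ := rfl

instance : Primcodable Edge := Primcodable.ofEquiv _ Edge.equivProd

def TA.equivProd : TA ≃ ℕ × List ℕ × ℕ × List Edge × List ℕ where
  toFun A := (A.numLocs, A.init, A.numClocks, A.edges, A.final)
  invFun p := ⟨p.1, p.2.1, p.2.2.1, p.2.2.2.1, p.2.2.2.2⟩
  left_inv _ := rfl
  right_inv _ := rfl

instance : Primcodable TA := Primcodable.ofEquiv _ TA.equivProd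

def CTA.equivProd : CTA ≃ List TA × ℕ × ℕ × List (ℕ × ℕ) where
  toFun N := (N.automata, N.numGlobals, N.numMsgs, N.channels)
  invFun p := ⟨p.1, p.2.1, p.2.2.1, p.2.2.2⟩
  left_inv _ := rfl
  right_inv _ := rfl

instance : Primcodable CTA := Primcodable.ofEquiv _ CTA.equivProd

/-! Well-formedness: everything that is used has been declared. -/

namespace CTA

/-- The clock is a declared local clock of `A` or a declared global clock of `N`. -/
def Declares (N : CTA) (A : TA) : Clock → Prop
  | .priv x => x < A.numClocks
  | .glob x => x < N.numGlobals

/-- The automaton number `i` may use this operation: the channel exists, with `i` as its writer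
or reader respectively, and the message belongs to the channel alphabet. -/
def OpOk (N : CTA) (i : ℕ) : ChanOp → Prop
  | .nop => True
  | .write j a => (i, j) ∈ N.channels ∧ a < N.numMsgs
  | .read j a _ => (j, i) ∈ N.channels ∧ a < N.numMsgs

structure WellFormed (N : CTA) : Prop where
  channels_lt : ∀ p ∈ N.channels, p.1 < N.automata.length ∧ p.2 < N.automata.length
  init_lt : ∀ A ∈ N.automata, ∀ l ∈ A.init, l < A.numLocs
  final_lt : ∀ A ∈ N.automata, ∀ l ∈ A.final, l < A.numLocs
  /-- Every automaton has exactly one initial location. -/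
  init_unique : ∀ A ∈ N.automata, ∃ l, A.init = [l]
  edges_ok : ∀ i : Fin N.automata.length, ∀ e ∈ (N.automata.get i).edges,
    e.src < (N.automata.get i).numLocs ∧ e.tgt < (N.automata.get i).numLocs ∧
    (∀ c ∈ e.guard, N.Declares (N.automata.get i) c.clock) ∧
    (∀ x ∈ e.resets, N.Declares (N.automata.get i) x) ∧
    N.OpOk i e.op

end CTA

/-! Semantics. -/

/-- A configuration of a network of `n` automata: control locations, values of local and global
clocks, and channel contents.  A channel content is a word of pairs (message, age); messages enter
at the left end of the word and leave at its right end.  Undeclared clocks have a value, too, which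
no transition of a well-formed network can look at. -/
structure Config (n : ℕ) where
  loc : Fin n → ℕ
  clk : Fin n → ℕ → ℕ
  glob : ℕ → ℕ
  chan : Fin n → Fin n → List (ℕ × ℕ)

namespace Config

variable {n : ℕ}

/-- The valuation seen by automaton `i`, on its local clocks and the global clocks. -/
def val (γ : Config n) (i : Fin n) : Clock → ℕ
  | .priv x => γ.clk i x
  | .glob x => γ.glob x

/-- Passage of `t` time units: all clocks and all ages of messages grow by `t`. -/
def elapse (γ : Config n) (t : ℕ) : Config n where
  loc := γ.loc
  clk := fun i x => γ.clk i x + t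
  glob := fun x => γ.glob x + t
  chan := fun i j => (γ.chan i j).map fun p => (p.1, p.2 + t)

/-- Automaton `i` moves to location `l` and resets the clocks in `Y`; channels do not change. -/
def move (γ : Config n) (i : Fin n) (Y : List Clock) (l : ℕ) : Config n where
  loc := Function.update γ.loc i l
  clk := Function.update γ.clk i fun x => if Clock.priv x ∈ Y then 0 else γ.clk i x
  glob := fun x => if Clock.glob x ∈ Y then 0 else γ.glob x
  chan := γ.chan

/-- Replace the content of the channel from `i` to `j` by `w`. -/
def setChan (γ : Config n) (i j : Fin n) (w : List (ℕ × ℕ)) : Config n :=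
  { γ with chan := Function.update γ.chan i (Function.update (γ.chan i) j w) }

end Config

namespace CTA

/-- Edge `e` of automaton `i` is enabled, as far as its location and its clocks are concerned. -/
def Enabled (N : CTA) (γ : Config N.automata.length) (i : Fin N.automata.length) (e : Edge) : Prop :=
  e ∈ (N.automata.get i).edges ∧ γ.loc i = e.src ∧ e.guard.Sat (γ.val i)

/-- One transition, timed or discrete, between configurations. -/
inductive Step (N : CTA) : Config N.automata.length → Config N.automata.length → Prop
  | time (γ : Config N.automata.length) (t : ℕ) : Step N γ (γ.elapse t)
  | nop (γ : Config N.automata.length) (i : Fin N.automata.length) (e : Edge)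
      (he : N.Enabled γ i e) (hop : e.op = .nop) :
      Step N γ (γ.move i e.resets e.tgt)
  | write (γ : Config N.automata.length) (i j : Fin N.automata.length) (a : ℕ) (e : Edge)
      (he : N.Enabled γ i e) (hop : e.op = .write j a) :
      Step N γ ((γ.move i e.resets e.tgt).setChan i j ((a, 0) :: γ.chan i j))
  | read (γ : Config N.automata.length) (i j : Fin N.automata.length) (a : ℕ) (I : AgeInterval)
      (e : Edge) (w : List (ℕ × ℕ)) (t : ℕ)
      (he : N.Enabled γ i e) (hop : e.op = .read j a I)
      (hc : γ.chan j i = w ++ [(a, t)]) (ht : I.Mem t) :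
      Step N γ ((γ.move i e.resets e.tgt).setChan j i w)

/-- Initial configurations: initial locations, all clocks `0`, all channels empty. -/
def IsInitial (N : CTA) (γ : Config N.automata.length) : Prop :=
  (∀ i, γ.loc i ∈ (N.automata.get i).init) ∧ (∀ i x, γ.clk i x = 0) ∧ (∀ x, γ.glob x = 0) ∧
    ∀ i j, γ.chan i j = []

/-- The control location `l` of the automaton number `k` is reachable. -/
def LocReachable (N : CTA) (k l : ℕ) : Prop :=
  ∃ γ₀ γ : Config N.automata.length, N.IsInitial γ₀ ∧ Relation.ReflTransGen N.Step γ₀ γ ∧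
    ∃ i : Fin N.automata.length, (i : ℕ) = k ∧ γ.loc i = l

end CTA

/-! The decision problem. -/

/-- An instance of the reachability problem: a network, the number of one of its automata, and a
control location of this automaton. -/
abbrev ReachInstance : Type := CTA × ℕ × ℕ

def ReachInstance.Valid (p : ReachInstance) : Prop :=
  p.1.WellFormed ∧ ∃ i : Fin p.1.automata.length, (i : ℕ) = p.2.1 ∧
    p.2.2 < (p.1.automata.get i).numLocs

/-- The question: is the given location reachable? -/
def Reachability (p : ReachInstance) : Prop := p.1.LocReachable p.2.1 p.2.2

/-- The decision problem `Q`, restricted to the instances in `P`, is undecidable: no algorithm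
answers it correctly on all instances in `P`, whatever it answers on other inputs. -/
def UndecidableOn {α : Type} [Primcodable α] (P Q : α → Prop) : Prop :=
  ¬ ∃ D : α → Prop, ComputablePred D ∧ ∀ x, P x → (D x ↔ Q x)

end CommTA

/-! ### A fixed Turing machine with undecidable halting problem. -/

namespace CommTA

open Turing StateTransition

/-! The halting problem of one fixed Turing machine, supplied by
`exists_machine_not_computablePred`, is reduced to reachability. State and tape form a circular
word, on which a Post normal system imitates the machine by local rewriting
(`TapeCode.postHalts_iff`). A finite control with one queue executes such a system letter by letter
(`Post.qReach_program_iff`). Hence reachability of location `0` is undecidable for queue machines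
over a fixed alphabet of `m` letters.

In a network the two ends of the queue belong to different automata, and the channel only leads from
the writer to the reader. The control sits in the writer, so each letter taken out must be reported
back through the single global clock. Time is cut into periods of length `m + 1`. The writer sends
letters only at the start of a period. The reader takes out `a` at time `a + 1` and resets the
global clock, which therefore shows `m - a` at the end of the period; the writer tests its guess of
the letter against this value. Without a reset the clock shows at least `m + 1`, so a missing letter
cannot be mistaken for a letter. An automaton whose local clock passes `m + 1` is blocked forever,
because its guards are equalities with smaller or equal constants; `NetInv.netStep` shows that lost
synchronisation creates no false runs. Both directions meet in `network_locReachable_iff`. Message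
ages play no role. -/

/-- Binary increment, least significant digit first. -/
def binSucc : List Bool → List Bool
  | [] => [true]
  | false :: l => true :: l
  | true :: l => false :: binSucc l

/-- The binary digits of a number, least significant digit first. -/
def binDigits : ℕ → List Bool
  | 0 => []
  | n + 1 => binSucc (binDigits n)

theorem primrec_binSucc : Primrec binSucc := by
  have h : Primrec fun l : List Bool =>
      (List.rec [true] (fun b t ih => if b = true then false :: ih else true :: t) l :
        List Bool) := by
    refine Primrec.list_rec (h := fun _ p => if p.1 = true then false :: p.2.2 else true :: p.2.1)
      Primrec.id (Primrec.const _) ?_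
    refine Primrec.ite ?_ ?_ ?_
    · exact Primrec.eq.comp (Primrec.fst.comp Primrec.snd) (Primrec.const true)
    · exact Primrec.list_cons.comp (Primrec.const _)
        (Primrec.snd.comp (Primrec.snd.comp Primrec.snd))
    · exact Primrec.list_cons.comp (Primrec.const _)
        (Primrec.fst.comp (Primrec.snd.comp Primrec.snd))
  refine h.of_eq fun l => ?_
  induction l with
  | nil => rfl
  | cons b l ih => cases b <;> simp_all [binSucc]

theorem primrec_binDigits : Primrec binDigits := by
  have h : Primrec fun n : ℕ => (Nat.rec [] (fun _ l => binSucc l) n : List Bool) :=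
    Primrec.nat_rec₁ _ (primrec_binSucc.comp Primrec.snd)
  refine h.of_eq fun n => ?_
  induction n with
  | zero => rfl
  | succ n ih => simp_all [binDigits]

/-- The symbol that the stack machine of `Turing.PartrecToTM2` uses for a binary digit. -/
def digitSymbol : Bool → PartrecToTM2.Γ'
  | false => .bit0
  | true => .bit1

theorem trPosNum_succ (p : PosNum) : ∀ l : List Bool,
    PartrecToTM2.trPosNum p = l.map digitSymbol →
    PartrecToTM2.trPosNum p.succ = (binSucc l).map digitSymbol := by
  induction p with
  | one =>
    rintro (_ | ⟨_ | _, l⟩) h <;>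
      simp_all [PartrecToTM2.trPosNum, PosNum.succ, binSucc, digitSymbol]
  | bit0 p ih =>
    rintro (_ | ⟨_ | _, l⟩) h <;>
      simp_all [PartrecToTM2.trPosNum, PosNum.succ, binSucc, digitSymbol]
  | bit1 p ih =>
    rintro (_ | ⟨_ | _, l⟩) h <;>
      simp_all [PartrecToTM2.trPosNum, PosNum.succ, binSucc, digitSymbol]
    exact ih _ rfl

/-- The recursion behind `binDigits` is visibly primitive recursive, so this equation makes the
machine's input tape computable from `n`. -/
theorem trNat_eq_binDigits (n : ℕ) :
    PartrecToTM2.trNat n = (binDigits n).map digitSymbol := by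
  induction n with
  | zero => simp [binDigits]
  | succ n ih =>
    rw [PartrecToTM2.trNat, Nat.cast_succ, Num.add_one, binDigits]
    rw [PartrecToTM2.trNat] at ih
    generalize (n : Num) = m at ih
    cases m with
    | zero =>
      have : binDigits n = [] := by
        simpa [PartrecToTM2.trNum] using ih.symm
      rw [this]
      rfl
    | pos p => exact trPosNum_succ p _ ih

/-- A code, with inputs consisting of one number, whose halting problem is undecidable. -/
theorem exists_code_not_computablePred : ∃ c : ToPartrec.Code,
    ¬ ComputablePred fun n : ℕ => (c.eval [n]).Dom := by
  -- A universal function: `n` is decoded to a program, which is run on `0`.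
  have hf : Partrec fun n : ℕ => Nat.Partrec.Code.eval (Denumerable.ofNat _ n) 0 :=
    Nat.Partrec.Code.eval_part.comp (Computable.ofNat _) (Computable.const 0)
  obtain ⟨c, hc⟩ := ToPartrec.Code.exists_code (Nat.Partrec'.part_iff₁.2 hf)
  refine ⟨c, fun h => ComputablePred.halting_problem 0 ?_⟩
  have h' := ComputablePred.computable_iff.1 h
  obtain ⟨f, hf, e⟩ := h'
  refine ComputablePred.computable_iff.2 ⟨fun c => f (Encodable.encode c),
    hf.comp Computable.encode, funext fun d => ?_⟩
  rw [← congrFun e]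
  have := hc ⟨[Encodable.encode d], rfl⟩
  simp only at this
  rw [this]
  simp [List.Vector.head]

/-- The code is compiled to a stack machine and then through `TM1` to `TM0`; each translation
preserves halting. Only a finite set of states supports the run, and the machine is restricted to
it. -/
theorem exists_machine_not_computablePred :
    ∃ (Γ Λ : Type) (_ : Inhabited Γ) (_ : Inhabited Λ) (_ : Finite Γ) (_ : Finite Λ)
      (M : TM0.Machine Γ Λ) (a : Γ) (d : Bool → Γ),
      ¬ ComputablePred fun n : ℕ =>
        (eval (TM0.step M) (TM0.init (a :: (binDigits n).reverse.map d))).Dom := by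
  obtain ⟨c, hc⟩ := exists_code_not_computablePred
  -- Machines start in the default state, so the default must be the entry point of `c`.
  let : Inhabited PartrecToTM2.Λ' :=
    ⟨PartrecToTM2.trNormal c PartrecToTM2.Cont'.halt⟩
  have hs₂ : TM2.Supports PartrecToTM2.tr _ :=
    PartrecToTM2.tr_supports c PartrecToTM2.Cont'.halt
  have hs₁ := TM2to1.tr_supports _ hs₂
  have hs₀ := TM1to0.tr_supports _ hs₁
  set M := TM1to0.tr (TM2to1.tr PartrecToTM2.tr) with hM
  set S := TM1to0.trStmts (TM2to1.tr PartrecToTM2.tr) (TM2to1.trSupp PartrecToTM2.tr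
    (PartrecToTM2.codeSupp c PartrecToTM2.Cont'.halt))
  let : Inhabited S := ⟨⟨default, hs₀.1⟩⟩
  classical
  have : Finite PartrecToTM2.K' :=
    Finite.of_surjective ![.main, .rev, .aux, .stack] (by
      rintro (_ | _ | _ | _)
      exacts [⟨0, rfl⟩, ⟨1, rfl⟩, ⟨2, rfl⟩, ⟨3, rfl⟩])
  -- A retraction onto the supporting states; its values elsewhere do not matter, since the run
  -- never leaves `S`.
  let g : PointedMap (TM1to0.Λ' (TM2to1.tr PartrecToTM2.tr)) S :=
    ⟨fun q => if h : q ∈ S then ⟨q, h⟩ else default, dif_pos hs₀.1⟩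
  let f : PointedMap (TM2to1.Γ' PartrecToTM2.K' fun _ => PartrecToTM2.Γ')
      (TM2to1.Γ' PartrecToTM2.K' fun _ => PartrecToTM2.Γ') := ⟨id, rfl⟩
  have hres := M.map_respects f f g Subtype.val hs₀ (fun _ => rfl)
    (fun q (hq : q ∈ S) => by simp [g, hq])
  let k := PartrecToTM2.K'.main
  let sym : PartrecToTM2.Γ' → TM2to1.Γ' PartrecToTM2.K' fun _ => PartrecToTM2.Γ' :=
    fun s => (false, Function.update (fun _ => none) k (some s))
  refine ⟨_, S, inferInstance, inferInstance, inferInstanceAs (Finite (Bool × (PartrecToTM2.K' → Option PartrecToTM2.Γ'))), inferInstance,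
    M.map f f g Subtype.val, (true, (sym .cons).2), fun b => sym (digitSymbol b), ?_⟩
  refine fun h => hc (h.of_eq fun n => ?_)
  have hinit : TM2to1.trInit k (PartrecToTM2.trList [n]) =
      (true, (sym .cons).2) :: (binDigits n).reverse.map fun b => sym (digitSymbol b) := by
    have hr : (PartrecToTM2.trList [n]).reverse =
        .cons :: (binDigits n).reverse.map digitSymbol := by
      simp [PartrecToTM2.trList, trNat_eq_binDigits]
    rw [TM2to1.trInit, hr]
    exact congrArg (List.cons _) (List.map_map ..)
  have h₀ : PartrecToTM2.init c [n] = TM2.init k (PartrecToTM2.trList [n]) := by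
    simp only [PartrecToTM2.init, TM2.init]
    congr 1
    funext k'
    cases k' <;> rfl
  have e₃ : (eval (TM0.step (M.map f f g Subtype.val)) (TM0.init
      ((true, (sym .cons).2) :: (binDigits n).reverse.map fun b => sym (digitSymbol b)))).Dom ↔
      (eval (TM0.step M) (TM0.init (TM2to1.trInit k (PartrecToTM2.trList [n])))).Dom := by
    refine tr_eval_dom hres ⟨hs₀.1, ?_⟩
    rw [TM0.map_init, hinit]
    congr 1
    exact List.map_id _
  have e₂ : (TM0.eval M (TM2to1.trInit k (PartrecToTM2.trList [n]))).Dom ↔ _ :=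
    iff_of_eq (congrArg Part.Dom (TM1to0.tr_eval _ _))
  have e₁ := TM2to1.tr_eval_dom PartrecToTM2.tr k (PartrecToTM2.trList [n])
  have e₀ := congrArg Part.Dom (PartrecToTM2.tr_eval c [n])
  rw [h₀] at e₀
  exact (e₃.trans e₂).trans (e₁.trans (iff_of_eq e₀))

end CommTA

/-! ### Post normal systems simulate Turing machines. -/

namespace CommTA

open Turing StateTransition Relation

/-- One step of a Post normal system with rules `u ↦ v`, where `u = a :: r` is not empty: remove `u`
at the right end of a word and add `v` at the left end. -/
inductive PostStep (R : ℕ → List ℕ → List ℕ → Prop) : List ℕ → List ℕ → Prop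
  | mk (x : List ℕ) (a : ℕ) (r v : List ℕ) (h : R a r v) : PostStep R (x ++ a :: r) (v ++ x)

/-- Starting with `w`, the Post normal system can reach a word that ends with some `a :: r`
in `H`. -/
def PostHalts (R : ℕ → List ℕ → List ℕ → Prop) (H : ℕ → List ℕ → Prop) (w : List ℕ) : Prop :=
  ∃ x a r, H a r ∧ ReflTransGen (PostStep R) w (x ++ a :: r)

/-- A rule `a ↦ a` carries the last letter to the front, and iterating this gives all rotations.
Words thus count as circular, and a rule applies at any place. -/
theorem PostStep.reaches_of_isRotated {R : ℕ → List ℕ → List ℕ → Prop} {w w' : List ℕ}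
    (hR : ∀ a ∈ w, R a [] [a]) (h : w ~r w') : ReflTransGen (PostStep R) w w' := by
  obtain ⟨n, rfl⟩ := h.symm
  clear h
  simp only [List.mem_rotate] at hR
  induction n with
  | zero => simpa using ReflTransGen.refl
  | succ n ih =>
    rcases hw : w'.rotate n with _ | ⟨a, l⟩
    · obtain rfl : w' = [] := by simpa using hw
      rw [List.rotate_nil]
    · refine ReflTransGen.head ?_ ih
      rw [← List.rotate_rotate, hw, List.rotate_cons_succ, List.rotate_zero]
      exact .mk l a [] [a] (hR a (by rw [← List.mem_rotate (n := n), hw]; simp))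

theorem PostStep.reaches_of_rule {R : ℕ → List ℕ → List ℕ → Prop} {w k r v : List ℕ} {a : ℕ}
    (hR : ∀ a ∈ w, R a [] [a]) (h : w ~r a :: r ++ k) (hv : R a r v) :
    ReflTransGen (PostStep R) w (v ++ k) :=
  (reaches_of_isRotated hR (h.trans List.isRotated_append)).tail (.mk k a r v hv)

/-- An injective numbering of the symbols and states of a Turing machine and a separator. -/
structure TapeCode (Γ Λ : Type) where
  size : ℕ
  sym : Γ → ℕ
  st : Λ → ℕ
  sep : ℕ
  sym_lt : ∀ a, sym a < size
  st_lt : ∀ q, st q < size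
  sep_lt : sep < size
  sym_inj : Function.Injective sym
  st_inj : Function.Injective st
  sym_ne_st : ∀ a q, sym a ≠ st q
  sym_ne_sep : ∀ a, sym a ≠ sep
  st_ne_sep : ∀ q, st q ≠ sep

theorem TapeCode.exists (Γ Λ : Type) [Finite Γ] [Finite Λ] : Nonempty (TapeCode Γ Λ) := by
  obtain ⟨n, ⟨e⟩⟩ := Finite.exists_equiv_fin (Option (Γ ⊕ Λ))
  exact ⟨n, fun a => e (some (.inl a)), fun q => e (some (.inr q)), e none,
    fun _ => Fin.is_lt _, fun _ => Fin.is_lt _, Fin.is_lt _,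
    fun a b h => by simpa [Fin.val_inj] using h, fun a b h => by simpa [Fin.val_inj] using h,
    fun a q h => by simp [Fin.val_inj] at h, fun a h => by simp [Fin.val_inj] at h,
    fun a h => by simp [Fin.val_inj] at h⟩

namespace TapeCode

variable {Γ Λ : Type} (C : TapeCode Γ Λ)

/-- The word for the tape with left part `l`, nearest symbol first, and right part `r`, read from
behind the state. -/
def tapeWord (l r : List Γ) : List ℕ := r.map C.sym ++ C.sep :: l.reverse.map C.sym

variable {C}

theorem tapeWord_cons_left (a : Γ) (l r : List Γ) :
    C.tapeWord (a :: l) r = C.tapeWord l r ++ [C.sym a] := by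
  simp [tapeWord]

theorem mem_tapeWord_lt {l r : List Γ} {a : ℕ} (h : a ∈ C.tapeWord l r) : a < C.size := by
  simp only [tapeWord, List.mem_append, List.mem_map, List.mem_cons, List.mem_reverse] at h
  rcases h with ⟨b, -, rfl⟩ | rfl | ⟨b, -, rfl⟩
  exacts [C.sym_lt b, C.sep_lt, C.sym_lt b]

theorem st_notMem_tapeWord (q : Λ) (l r : List Γ) : C.st q ∉ C.tapeWord l r := by
  simp [tapeWord, C.sym_ne_st, C.st_ne_sep]

theorem mem_lt_of_isRotated {q : Λ} {l r : List Γ} {w : List ℕ}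
    (h : w ~r C.st q :: C.tapeWord l r) {a : ℕ} (ha : a ∈ w) : a < C.size := by
  rcases List.mem_cons.1 (h.mem_iff.1 ha) with rfl | ha
  exacts [C.st_lt q, mem_tapeWord_lt ha]

/-- The state letter occurs only once in the circular word, so it determines where the word is cut;
a proper rotation would put a second one into the tape word. -/
theorem eq_of_isRotated_tapeWord {q q' : Λ} {l r : List Γ} {k : List ℕ}
    (h : C.st q' :: k ~r C.st q :: C.tapeWord l r) : q' = q ∧ k = C.tapeWord l r := by
  obtain ⟨n, hn, h⟩ := List.isRotated_iff_mod.1 h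
  rw [List.rotate_eq_drop_append_take hn] at h
  rcases n with _ | n
  · simp only [List.drop_zero, List.take_zero, List.append_nil, List.cons.injEq] at h
    exact ⟨C.st_inj h.1, h.2⟩
  · rw [List.drop_succ_cons, List.take_succ_cons] at h
    rcases hk : k.drop n with _ | ⟨a, k'⟩
    · rw [List.drop_eq_nil_iff] at hk
      rw [List.drop_eq_nil_of_le hk, List.take_of_length_le hk] at h
      simp only [List.nil_append, List.cons.injEq] at h
      exact ⟨C.st_inj h.1, h.2⟩
    · rw [hk] at h
      simp only [List.cons_append, List.cons.injEq] at h
      refine absurd ?_ (st_notMem_tapeWord (C := C) q' l r)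
      rw [← h.2]
      simp

theorem sym_cons_eq_tapeWord {a : Γ} {k : List ℕ} {l r : List Γ}
    (h : C.sym a :: k = C.tapeWord l r) : ∃ r', r = a :: r' ∧ k = C.tapeWord l r' := by
  rcases r with _ | ⟨b, r⟩
  · simp [tapeWord, C.sym_ne_sep] at h
  · simp only [tapeWord, List.map_cons, List.cons_append, List.cons.injEq] at h
    exact ⟨r, by rw [C.sym_inj h.1], h.2⟩

theorem concat_sym_eq_tapeWord {c : Γ} {k : List ℕ} {l r : List Γ}
    (h : k ++ [C.sym c] = C.tapeWord l r) : ∃ l', l = c :: l' ∧ k = C.tapeWord l' r := by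
  rcases l with _ | ⟨b, l⟩
  · have := congrArg List.getLast? h
    simp [tapeWord, C.sym_ne_sep] at this
  · rw [tapeWord_cons_left] at h
    obtain ⟨h₁, h₂⟩ := List.append_inj' h rfl
    exact ⟨l, by simpa [C.sym_inj.eq_iff, eq_comm] using h₂, h₁⟩

theorem sep_cons_eq_tapeWord {k : List ℕ} {l r : List Γ}
    (h : C.sep :: k = C.tapeWord l r) : r = [] ∧ k = l.reverse.map C.sym := by
  rcases r with _ | ⟨b, r⟩
  · simpa [tapeWord] using h
  · simp [tapeWord, (C.sym_ne_sep _).symm] at h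

theorem concat_sep_eq_tapeWord {k : List ℕ} {l r : List Γ}
    (h : k ++ [C.sep] = C.tapeWord l r) : l = [] ∧ k = r.map C.sym := by
  rcases l with _ | ⟨b, l⟩
  · simpa [tapeWord] using h
  · rw [tapeWord_cons_left] at h
    have := (List.append_inj' h rfl).2
    simp [(C.sym_ne_sep _).symm] at this

variable (C) [Inhabited Γ] [Inhabited Λ] (M : TM0.Machine Γ Λ)

/-- The rules by which a Post normal system simulates a Turing machine.  A configuration is stored
as a circular word: separator, left part of the tape, state, right part of the tape with the scanned
symbol. -/
inductive Rule : ℕ → List ℕ → List ℕ → Prop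
  | rotate (a : ℕ) (ha : a < C.size) : Rule a [] [a]
  | extendRight (q : Λ) : Rule (C.st q) [C.sep] [C.st q, C.sym default, C.sep]
  | extendLeft (q : Λ) : Rule C.sep [C.st q] [C.sep, C.sym default, C.st q]
  | write (q : Λ) (a : Γ) (q' : Λ) (b : Γ) (h : M q a = some (q', .write b)) :
      Rule (C.st q) [C.sym a] [C.st q', C.sym b]
  | right (q : Λ) (a : Γ) (q' : Λ) (h : M q a = some (q', .move .right)) :
      Rule (C.st q) [C.sym a] [C.sym a, C.st q']
  | left (q : Λ) (a : Γ) (q' : Λ) (h : M q a = some (q', .move .left)) (c : Γ) :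
      Rule (C.sym c) [C.st q, C.sym a] [C.st q', C.sym c, C.sym a]

/-- The pairs of a state and a scanned symbol for which the machine halts. -/
inductive Halt : ℕ → List ℕ → Prop
  | mk (q : Λ) (a : Γ) (h : M q a = none) : Halt (C.st q) [C.sym a]

/-- The circular word `w` represents the configuration `c`. -/
def Encodes (c : TM0.Cfg Γ Λ) (w : List ℕ) : Prop :=
  ∃ l r : List Γ, c.Tape = Tape.mk' (ListBlank.mk l) (ListBlank.mk r) ∧
    w ~r C.st c.q :: C.tapeWord l r

variable {C M}

theorem mk_singleton_default : ListBlank.mk [(default : Γ)] = ListBlank.mk [] := by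
  have := ListBlank.cons_head_tail (ListBlank.mk ([] : List Γ))
  simpa using this

theorem reaches_of_isRotated {q : Λ} {l r : List Γ} {w w' : List ℕ}
    (h : w ~r C.st q :: C.tapeWord l r) (h' : w ~r w') :
    ReflTransGen (PostStep (C.Rule M)) w w' :=
  PostStep.reaches_of_isRotated (fun _ ha => .rotate _ (mem_lt_of_isRotated h ha)) h'

theorem reaches_of_rule {q : Λ} {l r : List Γ} {w k u v : List ℕ} {a : ℕ}
    (h : w ~r C.st q :: C.tapeWord l r) (hv : C.Rule M a u v) (h' : w ~r a :: u ++ k) :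
    ReflTransGen (PostStep (C.Rule M)) w (v ++ k) :=
  PostStep.reaches_of_rule (fun _ ha => .rotate _ (mem_lt_of_isRotated h ha)) h' hv

/-- Before a step, a blank can be added on the right so that there is a scanned symbol. -/
theorem reaches_scanned {q : Λ} {T : Tape Γ} {w : List ℕ} (h : C.Encodes ⟨q, T⟩ w) :
    ∃ (w' : List ℕ) (l r : List Γ) (a : Γ), ReflTransGen (PostStep (C.Rule M)) w w' ∧
      T = Tape.mk' (ListBlank.mk l) (ListBlank.mk (a :: r)) ∧
      w' ~r C.st q :: C.tapeWord l (a :: r) := by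
  obtain ⟨l, _ | ⟨a, r⟩, hT, hw⟩ := h
  · refine ⟨_, l, [], default, reaches_of_rule hw (.extendRight q) (k := l.reverse.map C.sym) ?_,
      ?_, ?_⟩
    · simpa [tapeWord] using hw
    · rw [mk_singleton_default]; exact hT
    · simpa [tapeWord] using List.IsRotated.refl _
  · exact ⟨w, l, r, a, .refl, hT, hw⟩

/-- Before a move to the left, a blank can be added on the left. -/
theorem reaches_left {q : Λ} {l r : List Γ} {w : List ℕ} (hw : w ~r C.st q :: C.tapeWord l r) :
    ∃ (w' : List ℕ) (c : Γ) (l' : List Γ), ReflTransGen (PostStep (C.Rule M)) w w' ∧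
      ListBlank.mk l = ListBlank.mk (c :: l') ∧ w' ~r C.st q :: C.tapeWord (c :: l') r := by
  rcases l with _ | ⟨c, l⟩
  · refine ⟨_, default, [], reaches_of_rule hw (.extendLeft q) (k := r.map C.sym) ?_,
      mk_singleton_default.symm, ?_⟩
    · refine hw.trans ?_
      simpa [tapeWord] using (List.isRotated_append (l := [C.sep]) (l' := C.st q :: r.map C.sym)).symm
    · simpa [tapeWord] using
        List.isRotated_append (l := [C.sep, C.sym default]) (l' := C.st q :: r.map C.sym)
  · exact ⟨w, c, l, .refl, rfl, hw⟩

theorem reaches_of_step {c c' : TM0.Cfg Γ Λ} {w : List ℕ} (h : C.Encodes c w)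
    (hc : c' ∈ TM0.step M c) :
    ∃ w', ReflTransGen (PostStep (C.Rule M)) w w' ∧ C.Encodes c' w' := by
  obtain ⟨q, T⟩ := c
  obtain ⟨w', l, r, a, hr, rfl, hw⟩ := reaches_scanned (M := M) h
  obtain ⟨⟨q', s⟩, hM, rfl⟩ := Option.map_eq_some_iff.1 hc
  replace hM : M q a = some (q', s) := hM
  rcases s with (_ | _) | b
  · obtain ⟨w₂, c, l, hr₂, hl, hw⟩ := reaches_left (M := M) hw
    refine ⟨_, (hr.trans hr₂).trans (reaches_of_rule hw (.left q a q' hM c)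
      (k := r.map C.sym ++ C.sep :: l.reverse.map C.sym) ?_), l, c :: a :: r, ?_, ?_⟩
    · refine hw.trans ?_
      simpa [tapeWord] using (List.isRotated_append (l := [C.sym c])
        (l' := C.st q :: C.sym a :: (r.map C.sym ++ C.sep :: l.reverse.map C.sym))).symm
    · simp [hl]
    · simpa [tapeWord] using List.IsRotated.refl _
  · refine ⟨_, hr.trans (reaches_of_rule hw (.right q a q' hM)
      (k := r.map C.sym ++ C.sep :: l.reverse.map C.sym) ?_), a :: l, r, ?_, ?_⟩
    · simpa [tapeWord] using hw
    · simp
    · simpa [tapeWord] using (List.isRotated_append (l := [C.sym a])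
        (l' := C.st q' :: (r.map C.sym ++ C.sep :: l.reverse.map C.sym)))
  · refine ⟨_, hr.trans (reaches_of_rule hw (.write q a q' b hM)
      (k := r.map C.sym ++ C.sep :: l.reverse.map C.sym) ?_), l, b :: r, ?_, ?_⟩
    · simpa [tapeWord] using hw
    · simp [Tape.write_mk']
    · simpa [tapeWord] using List.IsRotated.refl _

/-- Every rule except rotation contains the state letter, which pins down the place of application.
Rotations and added blanks do not change the configuration; the other rules follow the transition
table. -/
theorem encodes_of_postStep {c : TM0.Cfg Γ Λ} {w w' : List ℕ} (h : C.Encodes c w)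
    (hw : PostStep (C.Rule M) w w') :
    C.Encodes c w' ∨ ∃ c' ∈ TM0.step M c, C.Encodes c' w' := by
  obtain ⟨q, T⟩ := c
  obtain ⟨l, r, rfl, h⟩ := h
  obtain ⟨x, a, u, v, hv⟩ := hw
  cases hv with
  | rotate a ha => exact .inl ⟨l, r, rfl, List.isRotated_append.symm.trans h⟩
  | extendRight q' =>
    obtain ⟨rfl, hk⟩ := eq_of_isRotated_tapeWord (List.isRotated_append.symm.trans h)
    obtain ⟨rfl, rfl⟩ := sep_cons_eq_tapeWord hk
    exact .inl ⟨l, [default], by rw [mk_singleton_default], by simpa [tapeWord] using List.IsRotated.refl _⟩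
  | extendLeft q' =>
    obtain ⟨rfl, hk⟩ := eq_of_isRotated_tapeWord (k := x ++ [C.sep]) ((List.isRotated_append
      (l := x ++ [C.sep]) (l' := [C.st q'])).symm.trans (by simpa using h))
    obtain ⟨rfl, rfl⟩ := concat_sep_eq_tapeWord hk
    refine .inl ⟨[default], r, by rw [mk_singleton_default], ?_⟩
    simpa [tapeWord] using
      List.isRotated_append (l := [C.sep, C.sym default]) (l' := C.st q' :: r.map C.sym)
  | write q' a q₂ b hM =>
    obtain ⟨rfl, hk⟩ := eq_of_isRotated_tapeWord (List.isRotated_append.symm.trans h)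
    obtain ⟨r, rfl, rfl⟩ := sym_cons_eq_tapeWord hk
    exact .inr ⟨⟨q₂, _⟩, Option.map_eq_some_iff.2 ⟨_, hM, rfl⟩, l, b :: r,
      by simp [Tape.write_mk'], by simpa [tapeWord] using List.IsRotated.refl _⟩
  | right q' a q₂ hM =>
    obtain ⟨rfl, hk⟩ := eq_of_isRotated_tapeWord (List.isRotated_append.symm.trans h)
    obtain ⟨r, rfl, rfl⟩ := sym_cons_eq_tapeWord hk
    refine .inr ⟨⟨q₂, _⟩, Option.map_eq_some_iff.2 ⟨_, hM, rfl⟩, a :: l, r, by simp, ?_⟩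
    simpa [tapeWord] using (List.isRotated_append (l := [C.sym a])
        (l' := C.st q₂ :: C.tapeWord l r))
  | left q' a q₂ hM b =>
    obtain ⟨rfl, hk⟩ := eq_of_isRotated_tapeWord (k := C.sym a :: (x ++ [C.sym b]))
      ((List.isRotated_append (l := x ++ [C.sym b]) (l' := [C.st q', C.sym a])).symm.trans
        (by simpa using h))
    obtain ⟨r, rfl, hx⟩ := sym_cons_eq_tapeWord hk
    obtain ⟨l, rfl, rfl⟩ := concat_sym_eq_tapeWord hx
    exact .inr ⟨⟨q₂, _⟩, Option.map_eq_some_iff.2 ⟨_, hM, rfl⟩, l, b :: a :: r,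
      by simp, by simpa [tapeWord] using List.IsRotated.refl _⟩

theorem postHalts_iff {c : TM0.Cfg Γ Λ} {w : List ℕ} (h : C.Encodes c w) :
    PostHalts (C.Rule M) (C.Halt M) w ↔ (eval (TM0.step M) c).Dom := by
  constructor
  · rintro ⟨x, _, _, ⟨q, a, hM⟩, hw⟩
    have : ∃ c', Reaches (TM0.step M) c c' ∧ C.Encodes c' (x ++ [C.st q, C.sym a]) := by
      generalize x ++ [C.st q, C.sym a] = w' at hw
      induction hw with
      | refl => exact ⟨c, .refl, h⟩
      | tail _ hs ih =>
        obtain ⟨c', hc, h'⟩ := ih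
        rcases encodes_of_postStep h' hs with h₂ | ⟨c₂, hc₂, h₂⟩
        exacts [⟨c', hc, h₂⟩, ⟨c₂, hc.tail hc₂, h₂⟩]
    obtain ⟨⟨q', T⟩, hc, l, r, rfl, hw'⟩ := this
    obtain ⟨rfl, hk⟩ := eq_of_isRotated_tapeWord (List.isRotated_append.symm.trans hw')
    obtain ⟨r, rfl, rfl⟩ := sym_cons_eq_tapeWord hk
    exact Part.dom_iff_mem.2 ⟨_, mem_eval.2 ⟨hc, Option.map_eq_none_iff.2 hM⟩⟩
  · intro hd
    obtain ⟨c', hm⟩ := Part.dom_iff_mem.1 hd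
    obtain ⟨hc, hn⟩ := mem_eval.1 hm
    have : ∃ w', ReflTransGen (PostStep (C.Rule M)) w w' ∧ C.Encodes c' w' := by
      clear hn hm hd
      induction hc with
      | refl => exact ⟨w, .refl, h⟩
      | tail _ hs ih =>
        obtain ⟨w', hw, h'⟩ := ih
        obtain ⟨w₂, hw₂, h₂⟩ := reaches_of_step h' hs
        exact ⟨w₂, hw.trans hw₂, h₂⟩
    obtain ⟨w', hw, h'⟩ := this
    obtain ⟨q, T⟩ := c'
    -- The halting pair needs an explicit letter for the scanned symbol, even if that symbol is an
    -- unwritten blank.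
    obtain ⟨w₂, l, r, a, hw₂, rfl, hr⟩ := reaches_scanned (M := M) h'
    refine ⟨C.tapeWord l r, _, _, .mk q a (Option.map_eq_none_iff.1 hn), ?_⟩
    refine (hw.trans hw₂).trans (reaches_of_isRotated hr (hr.trans ?_))
    exact List.isRotated_append (l := [C.st q, C.sym a]) (l' := C.tapeWord l r)

end TapeCode
end CommTA

/-! ### Queue machines simulate Post normal systems. -/

namespace CommTA

open Turing StateTransition Relation

/-- An instruction of a queue machine: source location, whether it writes (or else reads), letter,
target location. -/
abbrev QInstr : Type := ℕ × Bool × ℕ × ℕ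

/-- One step of a queue machine; letters are written at the left end of the queue and read at its
right end. -/
inductive QStep (P : List QInstr) : ℕ × List ℕ → ℕ × List ℕ → Prop
  | write (q a q' : ℕ) (w : List ℕ) (h : (q, true, a, q') ∈ P) : QStep P (q, w) (q', a :: w)
  | read (q a q' : ℕ) (w : List ℕ) (h : (q, false, a, q') ∈ P) : QStep P (q, w ++ [a]) (q', w)

/-- The queue machine can go from location `q₀` with the empty queue to location `q`. -/
def QReach (P : List QInstr) (q₀ q : ℕ) : Prop :=
  ∃ w, ReflTransGen (QStep P) (q₀, []) (q, w)

namespace Post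

/-- The location in which `r` has just been read and `s` is to be written. -/
def loc (r s : List ℕ) : ℕ := Encodable.encode (r, s) + 1

theorem loc_inj {r s r' s' : List ℕ} : loc r s = loc r' s' ↔ r = r' ∧ s = s' := by
  rw [loc, loc, Nat.add_right_cancel_iff, Encodable.encode_inj, Prod.mk.injEq]

/-- The nonempty suffixes of a list, as pairs of head and tail. -/
def suffixPairs : List ℕ → List (ℕ × List ℕ)
  | [] => []
  | a :: l => (a, l) :: suffixPairs l

/-- Instructions to read `u`, last letter first. -/
def reads (u : List ℕ) : List QInstr :=
  (suffixPairs u).map fun p => (loc p.2 [], false, p.1, loc (p.1 :: p.2) [])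

/-- Instructions to write `s`, first letter first. -/
def writes (s : List ℕ) : List QInstr :=
  (suffixPairs s).map fun p => (loc [] (p.1 :: p.2), true, p.1, loc [] p.2)

/-- Instructions to apply a rule. -/
def ruleInstrs (ρ : (ℕ × List ℕ) × List ℕ) : List QInstr :=
  reads ρ.1.2 ++ (loc ρ.1.2 [], false, ρ.1.1, loc [] ρ.2.reverse) :: writes ρ.2.reverse

/-- Instructions to halt. -/
def haltInstrs (η : ℕ × List ℕ) : List QInstr :=
  reads η.2 ++ [(loc η.2 [], false, η.1, 0)]

/-- A queue machine that first writes `s` and then simulates a Post normal system. -/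
def program (R : List ((ℕ × List ℕ) × List ℕ)) (H : List (ℕ × List ℕ)) (s : List ℕ) :
    List QInstr :=
  writes s ++ (R.flatMap ruleInstrs ++ H.flatMap haltInstrs)

theorem reaches_reads {P : List QInstr} (x : List ℕ) : ∀ {u : List ℕ}, reads u ⊆ P →
    ReflTransGen (QStep P) (loc [] [], x ++ u) (loc u [], x)
  | [], _ => by simpa using ReflTransGen.refl
  | a :: u, h => by
    have ih := reaches_reads (x ++ [a]) (u := u) fun i hi => h (by
      simp only [reads, suffixPairs, List.map_cons] at hi ⊢
      exact List.mem_cons_of_mem _ hi)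
    rw [List.append_assoc] at ih
    exact ih.tail (.read _ _ _ _ (h (by simp [reads, suffixPairs])))

theorem reaches_writes {P : List QInstr} : ∀ (x : List ℕ) {s : List ℕ}, writes s ⊆ P →
    ReflTransGen (QStep P) (loc [] s, x) (loc [] [], s.reverse ++ x)
  | x, [], _ => .refl
  | x, a :: s, h => by
    have ih := reaches_writes (a :: x) (s := s) fun i hi => h (by
      simp only [writes, suffixPairs, List.map_cons] at hi ⊢
      exact List.mem_cons_of_mem _ hi)
    rw [List.reverse_cons, List.append_assoc]
    exact ih.head (.write _ _ _ _ (h (by simp [writes, suffixPairs])))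

variable {R : List ((ℕ × List ℕ) × List ℕ)} {H : List (ℕ × List ℕ)} {s : List ℕ}

/-- Locations remember only what was read or is still to be written, so rules may share them. A
reading that matches no rule just gets stuck. Writing on the left reverses a word, hence the
reversals. -/
theorem qReach_program_iff :
    QReach (program R H s) (loc [] s) 0 ↔
      PostHalts (fun a r v => ((a, r), v) ∈ R) (fun a r => (a, r) ∈ H) s.reverse := by
  constructor
  · rintro ⟨w, hw⟩
    -- Invariant: putting back the letters read and adding the pending letters yields a word that
    -- the Post system reaches.
    suffices ∀ c, ReflTransGen (QStep (program R H s)) (loc [] s, []) c →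
        PostHalts (fun a r v => ((a, r), v) ∈ R) (fun a r => (a, r) ∈ H) s.reverse ∨
        ∃ r t, c.1 = loc r t ∧ ReflTransGen (PostStep fun a r v => ((a, r), v) ∈ R)
          s.reverse (t.reverse ++ c.2 ++ r) by
      rcases this _ hw with h | ⟨r, t, h, -⟩
      · exact h
      -- The successor in `loc` keeps `0` free for halting.
      · simp [loc] at h
    intro c hc
    induction hc with
    | refl => exact .inr ⟨[], s, rfl, by simpa using ReflTransGen.refl⟩
    | tail _ hs ih =>
      rcases ih with h | ⟨r, t, hq, h⟩
      · exact .inl h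
      cases hs with
      | write q a q' w hi =>
        simp only at hq h ⊢
        subst hq
        have : ∃ t', loc r t = loc [] (a :: t') ∧ q' = loc [] t' := by
          simp only [program, ruleInstrs, haltInstrs, reads, writes, List.mem_append,
            List.mem_map, List.mem_flatMap, List.mem_cons, Prod.mk.injEq] at hi
          aesop
        obtain ⟨t', ht, rfl⟩ := this
        obtain ⟨rfl, rfl⟩ := loc_inj.1 ht
        exact .inr ⟨[], t', rfl, by simpa using h⟩
      | read q a q' w hi =>
        simp only at hq h ⊢
        subst hq
        have : t = [] ∧ (q' = loc (a :: r) [] ∨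
            (∃ v, ((a, r), v) ∈ R ∧ q' = loc [] v.reverse) ∨ (a, r) ∈ H) := by
          simp only [program, ruleInstrs, haltInstrs, reads, writes, List.mem_append,
            List.mem_map, List.mem_flatMap, List.mem_cons, Prod.mk.injEq, loc_inj] at hi
          aesop
        obtain ⟨rfl, rfl | ⟨v, hv, rfl⟩ | hH⟩ := this
        · exact .inr ⟨a :: r, [], rfl, by simpa using h⟩
        · refine .inr ⟨[], v.reverse, rfl, ?_⟩
          refine h.tail ?_
          simpa using PostStep.mk (R := fun a r v => ((a, r), v) ∈ R) w a r v hv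
        · exact .inl ⟨w, a, r, hH, by simpa using h⟩
  · rintro ⟨x, a, r, hH, hw⟩
    have hR : ∀ {ρ}, ρ ∈ R → ruleInstrs ρ ⊆ program R H s := fun hρ i hi =>
      List.mem_append_right _ (List.mem_append_left _ (List.mem_flatMap.2 ⟨_, hρ, hi⟩))
    have hH' : haltInstrs (a, r) ⊆ program R H s := fun i hi =>
      List.mem_append_right _ (List.mem_append_right _ (List.mem_flatMap.2 ⟨_, hH, hi⟩))
    suffices ReflTransGen (QStep (program R H s)) (loc [] s, []) (loc [] [], x ++ a :: r) by
      refine ⟨x, this.trans ?_⟩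
      have h := reaches_reads (x ++ [a]) (fun i hi => hH' (List.mem_append_left _ hi))
      rw [List.append_assoc] at h
      exact h.tail (.read _ _ _ _ (hH' (by simp [haltInstrs])))
    generalize x ++ a :: r = w at hw
    induction hw with
    | refl => simpa using reaches_writes (P := program R H s) [] (List.subset_append_left _ _)
    | tail _ hs ih =>
      refine ih.trans ?_
      cases hs with
      | mk x a r v hv =>
        have h := reaches_reads (x ++ [a]) (fun i hi => hR hv (List.mem_append_left _ hi))
        rw [List.append_assoc] at h
        refine h.trans (ReflTransGen.head (.read _ a (loc [] v.reverse) _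
          (hR hv (by simp [ruleInstrs]))) ?_)
        simpa using reaches_writes x (s := v.reverse) fun i hi => hR hv (by
          simp [ruleInstrs, hi])

theorem mem_of_mem_suffixPairs {p : ℕ × List ℕ} : ∀ {l : List ℕ}, p ∈ suffixPairs l → p.1 ∈ l
  | [], h => by simp [suffixPairs] at h
  | a :: l, h => by
    rcases List.mem_cons.1 h with rfl | h
    · simp
    · exact List.mem_cons_of_mem _ (mem_of_mem_suffixPairs h)

theorem letter_lt_of_mem_program {m : ℕ} (hs : ∀ a ∈ s, a < m)
    (hR : ∀ ρ ∈ R, ρ.1.1 < m ∧ (∀ a ∈ ρ.1.2, a < m) ∧ ∀ a ∈ ρ.2, a < m)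
    (hH : ∀ η ∈ H, η.1 < m ∧ ∀ a ∈ η.2, a < m) {i : QInstr} (hi : i ∈ program R H s) :
    i.2.2.1 < m := by
  have hw : ∀ {t : List ℕ}, (∀ a ∈ t, a < m) → ∀ {i : QInstr}, i ∈ writes t → i.2.2.1 < m := by
    intro t ht i hi
    obtain ⟨p, hp, rfl⟩ := List.mem_map.1 hi
    exact ht _ (mem_of_mem_suffixPairs hp)
  have hr : ∀ {t : List ℕ}, (∀ a ∈ t, a < m) → ∀ {i : QInstr}, i ∈ reads t → i.2.2.1 < m := by
    intro t ht i hi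
    obtain ⟨p, hp, rfl⟩ := List.mem_map.1 hi
    exact ht _ (mem_of_mem_suffixPairs hp)
  simp only [program, List.mem_append, List.mem_flatMap, ruleInstrs, haltInstrs,
    List.mem_cons, List.not_mem_nil, or_false] at hi
  rcases hi with hi | ⟨ρ, hρ, hi | rfl | hi⟩ | ⟨η, hη, hi | rfl⟩
  · exact hw hs hi
  · exact hr (hR ρ hρ).2.1 hi
  · exact (hR ρ hρ).1
  · exact hw (fun a ha => (hR ρ hρ).2.2 a (List.mem_reverse.1 ha)) hi
  · exact hr (hH η hη).2 hi
  · exact (hH η hη).1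

theorem primrec_suffixPairs : Primrec suffixPairs := by
  have h : Primrec fun l : List ℕ =>
      (List.rec [] (fun a t ih => (a, t) :: ih) l : List (ℕ × List ℕ)) := by
    refine Primrec.list_rec (h := fun _ p => (p.1, p.2.1) :: p.2.2)
      Primrec.id (Primrec.const _) ?_
    refine Primrec.list_cons.comp (Primrec.pair (Primrec.fst.comp Primrec.snd)
      (Primrec.fst.comp (Primrec.snd.comp Primrec.snd)))
      (Primrec.snd.comp (Primrec.snd.comp Primrec.snd))
  refine h.of_eq fun l => ?_
  induction l with
  | nil => rfl
  | cons b l ih => simp_all [suffixPairs]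

theorem primrec_loc : Primrec₂ loc :=
  Primrec.succ.comp (Primrec.encode.comp (Primrec.pair Primrec.fst Primrec.snd))

theorem primrec_writes : Primrec writes := by
  have h₁ : Primrec fun p : List ℕ × (ℕ × List ℕ) => p.2.1 := Primrec.fst.comp Primrec.snd
  have h₂ : Primrec fun p : List ℕ × (ℕ × List ℕ) => p.2.2 := Primrec.snd.comp Primrec.snd
  refine Primrec.list_map primrec_suffixPairs
    (g := fun _ p => (loc [] (p.1 :: p.2), true, p.1, loc [] p.2)) ?_
  exact Primrec.pair (primrec_loc.comp (Primrec.const []) (Primrec.list_cons.comp h₁ h₂))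
    (Primrec.pair (Primrec.const true)
      (Primrec.pair h₁ (primrec_loc.comp (Primrec.const []) h₂)))

theorem primrec_program : Primrec (program R H) :=
  Primrec.list_append.comp primrec_writes (Primrec.const _)

end Post

/-! ### Undecidability for queue machines. -/

/-- Bounded letters and lengths make the rules and halting pairs finite sets. Since the Turing
machine is fixed, mere existence of lists of them suffices. -/
theorem finite_lists_bounded (n m : ℕ) :
    {l : List ℕ | l.length ≤ n ∧ ∀ a ∈ l, a < m}.Finite := by
  refine ((List.finite_length_le (Fin m) n).image (List.map Fin.val)).subset ?_
  rintro l ⟨hl, hm⟩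
  refine ⟨l.attach.map fun a => ⟨a.1, hm a.1 a.2⟩, by simpa using hl, ?_⟩
  rw [List.map_map]
  exact l.attach_map_subtype_val

namespace TapeCode

variable {Γ Λ : Type} [Inhabited Λ] {C : TapeCode Γ Λ} {M : TM0.Machine Γ Λ}

theorem Halt.bounded {a : ℕ} {r : List ℕ} (h : C.Halt M a r) :
    a < C.size ∧ (r.length ≤ 3 ∧ ∀ b ∈ r, b < C.size) := by
  cases h; simp [C.sym_lt, C.st_lt]

theorem exists_haltList (C : TapeCode Γ Λ) (M : TM0.Machine Γ Λ) :
    ∃ H : List (ℕ × List ℕ), ∀ a r, (a, r) ∈ H ↔ C.Halt M a r := by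
  have hf : {η : ℕ × List ℕ | C.Halt M η.1 η.2}.Finite :=
    ((Set.finite_lt_nat C.size).prod (finite_lists_bounded 3 C.size)).subset
        fun η hη => Halt.bounded hη
  exact ⟨hf.toFinset.toList, by simp⟩

variable [Inhabited Γ]

theorem Rule.bounded {a : ℕ} {r v : List ℕ} (h : C.Rule M a r v) :
    a < C.size ∧ (r.length ≤ 3 ∧ ∀ b ∈ r, b < C.size) ∧ (v.length ≤ 3 ∧ ∀ b ∈ v, b < C.size) := by
  cases h <;> simp_all [C.sym_lt, C.st_lt, C.sep_lt]

theorem exists_ruleList (C : TapeCode Γ Λ) (M : TM0.Machine Γ Λ) :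
    ∃ R : List ((ℕ × List ℕ) × List ℕ), ∀ a r v, ((a, r), v) ∈ R ↔ C.Rule M a r v := by
  have hf : {ρ : (ℕ × List ℕ) × List ℕ | C.Rule M ρ.1.1 ρ.1.2 ρ.2}.Finite :=
    (((Set.finite_lt_nat C.size).prod (finite_lists_bounded 3 C.size)).prod
      (finite_lists_bounded 3 C.size)).subset
        fun ρ hρ => ⟨⟨(Rule.bounded hρ).1, (Rule.bounded hρ).2.1⟩, (Rule.bounded hρ).2.2⟩
  exact ⟨hf.toFinset.toList, by simp⟩

end TapeCode

/-- Reachability is undecidable for queue machines over a fixed alphabet. -/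
theorem exists_program_not_computablePred :
    ∃ (m : ℕ) (P : ℕ → List QInstr) (q₀ : ℕ → ℕ), Computable P ∧ Computable q₀ ∧
      (∀ n, ∀ i ∈ P n, i.2.2.1 < m) ∧ ¬ ComputablePred fun n => QReach (P n) (q₀ n) 0 := by
  obtain ⟨Γ, Λ, _, _, _, _, M, a, d, hM⟩ := exists_machine_not_computablePred
  obtain ⟨C⟩ := TapeCode.exists Γ Λ
  obtain ⟨R, hR⟩ := C.exists_ruleList M
  obtain ⟨H, hH⟩ := C.exists_haltList M
  -- The reversal of the word for the initial configuration, whose left tape part is empty.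
  let s : ℕ → List ℕ := fun n =>
    C.sep :: ((binDigits n).map (fun b => C.sym (d b)) ++ [C.sym a, C.st default])
  have hs : Primrec s :=
    Primrec.list_cons.comp (Primrec.const _) (Primrec.list_append.comp
      (Primrec.list_map primrec_binDigits
        ((Primrec.dom_finite fun b => C.sym (d b)).comp Primrec.snd).to₂) (Primrec.const _))
  refine ⟨C.size, fun n => Post.program R H (s n), fun n => Post.loc [] (s n),
    (Post.primrec_program.comp hs).to_comp,
    (Post.primrec_loc.comp (Primrec.const []) hs).to_comp, fun n i hi => ?_, fun h => hM ?_⟩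
  · refine Post.letter_lt_of_mem_program ?_ ?_ ?_ hi
    · simp only [s, List.mem_cons, List.mem_append, List.mem_map, List.not_mem_nil]
      rintro b (rfl | ⟨c, -, rfl⟩ | rfl | rfl | h)
      exacts [C.sep_lt, C.sym_lt _, C.sym_lt _, C.st_lt _, h.elim]
    · rintro ⟨⟨a, r⟩, v⟩ hρ
      have := ((hR _ _ _).1 hρ).bounded
      exact ⟨this.1, this.2.1.2, this.2.2.2⟩
    · rintro ⟨a, r⟩ hη
      have := ((hH _ _).1 hη).bounded
      exact ⟨this.1, this.2.2⟩
  · refine h.of_eq fun n => ?_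
    rw [Post.qReach_program_iff]
    simp only [hR, hH]
    refine TapeCode.postHalts_iff ⟨[], _, rfl, ?_⟩
    change _ ~r C.st default :: _
    simpa [s, TapeCode.tapeWord, Function.comp_def] using List.IsRotated.refl _

end CommTA

/-! ### The network and its abstract transition system. -/

namespace CommTA

open Relation

/-! A queue machine as a network of two automata.  The two local clocks agree modulo `m + 1`, where
`m` is the number of letters.  The second automaton reads one letter in every period; when it reads
`a`, it resets the global clock `a + 1` time units after the beginning of the period.  At the end of
the period, the first automaton learns `a` from the value of the global clock. -/

/-- The edge of the first automaton for an instruction. -/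
def instrEdge (m : ℕ) (i : QInstr) : Edge :=
  if i.2.1 = true then
    ⟨i.1, [⟨.priv 0, .eq, 0⟩], .write 1 i.2.2.1, [], i.2.2.2⟩
  else
    ⟨i.1, [⟨.priv 0, .eq, m + 1⟩, ⟨.glob 0, .eq, m - i.2.2.1⟩], .nop, [.priv 0], i.2.2.2⟩

/-- The edge with which the second automaton reads the letter `a`. -/
def readEdge (a : ℕ) : Edge :=
  ⟨0, [⟨.priv 0, .eq, a + 1⟩], .read 0 a ⟨true, 0, none, false⟩, [.glob 0], 1⟩

/-- The edge with which the second automaton ends a period. -/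
def periodEdge (m : ℕ) : Edge :=
  ⟨1, [⟨.priv 0, .eq, m + 1⟩], .nop, [.priv 0], 0⟩

/-- A number above all locations that occur in the instructions. -/
def locBound (P : List QInstr) : ℕ := P.foldr (fun i n => i.1 + i.2.2.2 + n) 1

/-- The automaton that has the control of the queue machine and writes. -/
def writerTA (m : ℕ) (P : List QInstr) (q₀ : ℕ) : TA :=
  ⟨q₀ + locBound P, [q₀], 1, P.map (instrEdge m), []⟩

/-- The automaton that reads. -/
def readerTA (m : ℕ) : TA :=
  ⟨2, [0], 1, (List.range m).map readEdge ++ [periodEdge m], []⟩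

abbrev network (m : ℕ) (P : List QInstr) (q₀ : ℕ) : CTA :=
  ⟨[writerTA m P q₀, readerTA m], 1, m, [(0, 1)]⟩

variable {m : ℕ} {P : List QInstr} {q₀ : ℕ}

theorem one_le_locBound : 1 ≤ locBound P := by
  induction P with
  | nil => simp [locBound]
  | cons j P ih => simp only [locBound, List.foldr_cons] at ih ⊢; omega

theorem lt_locBound {i : QInstr} (h : i ∈ P) : i.1 < locBound P ∧ i.2.2.2 < locBound P := by
  induction P with
  | nil => simp at h
  | cons j P ih =>
    have h1 : 1 ≤ locBound P := one_le_locBound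
    have h2 : locBound (j :: P) = j.1 + j.2.2.2 + locBound P := rfl
    rcases List.mem_cons.1 h with rfl | h
    · omega
    · have := ih h; omega

theorem network_wellFormed (hP : ∀ i ∈ P, i.2.2.1 < m) : (network m P q₀).WellFormed where
  channels_lt := by simp
  init_lt := by
    have := one_le_locBound (P := P)
    simp [writerTA, readerTA]
    omega
  final_lt := by simp [writerTA, readerTA]
  init_unique := by simp [writerTA, readerTA]
  edges_ok := by
    rintro ⟨_ | _ | n, hn⟩ e he
    · obtain ⟨i, hi, rfl⟩ := List.mem_map.1 (show e ∈ P.map (instrEdge m) from he)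
      have h₁ := lt_locBound hi
      have h₂ := hP i hi
      change _ < q₀ + locBound P ∧ _ < q₀ + locBound P ∧ _
      rw [instrEdge]
      split_ifs <;> simp [CTA.OpOk, CTA.Declares, writerTA, h₂] <;> omega
    · have he' : e ∈ (List.range m).map readEdge ++ [periodEdge m] := he
      simp only [List.mem_append, List.mem_map, List.mem_range, List.mem_singleton] at he'
      rcases he' with ⟨a, ha, rfl⟩ | rfl
      · simp [readEdge, CTA.OpOk, CTA.Declares, readerTA, ha]
      · simp [periodEdge, CTA.OpOk, CTA.Declares, readerTA]
    · simp at hn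

/-- What matters of a configuration: location and clock of the first automaton, location and clock
of the second automaton, the global clock, and the letters in the channel. -/
@[ext]
structure NetState where
  (q x r y g : ℕ)
  w : List ℕ

def Config.netState (γ : Config 2) : NetState :=
  ⟨γ.loc 0, γ.clk 0 0, γ.loc 1, γ.clk 1 0, γ.glob 0, (γ.chan 0 1).map Prod.fst⟩

/-- The steps of the network. -/
inductive NetStep (m : ℕ) (P : List QInstr) : NetState → NetState → Prop
  | time (q x r y g : ℕ) (w : List ℕ) (t : ℕ) :
      NetStep m P ⟨q, x, r, y, g, w⟩ ⟨q, x + t, r, y + t, g + t, w⟩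
  | put (q a q' r y g : ℕ) (w : List ℕ) (h : (q, true, a, q') ∈ P) :
      NetStep m P ⟨q, 0, r, y, g, w⟩ ⟨q', 0, r, y, g, a :: w⟩
  | get (q a q' r y : ℕ) (w : List ℕ) (h : (q, false, a, q') ∈ P) :
      NetStep m P ⟨q, m + 1, r, y, m - a, w⟩ ⟨q', 0, r, y, m - a, w⟩
  | receive (q x a g : ℕ) (w : List ℕ) (h : a < m) :
      NetStep m P ⟨q, x, 0, a + 1, g, w ++ [a]⟩ ⟨q, x, 1, a + 1, 0, w⟩
  | period (q x g : ℕ) (w : List ℕ) :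
      NetStep m P ⟨q, x, 1, m + 1, g, w⟩ ⟨q, x, 0, 0, g, w⟩

theorem NetStep.of_eq {s t s' t' : NetState} (h : NetStep m P s t) (hs : s = s') (ht : t = t') :
    NetStep m P s' t' := hs ▸ ht ▸ h

theorem fin_two_eq (i : Fin 2) : i = 0 ∨ i = 1 := by
  fin_cases i <;> simp

/-- Ages and the remaining clocks can be forgotten: the only age interval is `[0, ∞)`, and no guard
tests another clock. With `step_of_netStep` the projection becomes a bisimulation. -/
theorem netStep_of_step {γ γ' : Config (network m P q₀).automata.length}
    (h : CTA.Step (network m P q₀) γ γ') :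
    NetStep m P (Config.netState γ) (Config.netState γ') := by
  cases h with
  | time t =>
    have := NetStep.time (m := m) (P := P) (γ.loc 0) (γ.clk 0 0) (γ.loc 1) (γ.clk 1 0) (γ.glob 0)
      ((γ.chan 0 1).map Prod.fst) t
    simpa [Config.netState, Config.elapse, Function.comp_def] using this
  | nop i e he hop =>
    obtain ⟨he, hl, hg⟩ := he
    obtain rfl | rfl := fin_two_eq i
    · obtain ⟨⟨q, b, a, q'⟩, hi, rfl⟩ := List.mem_map.1 (show e ∈ P.map (instrEdge m) from he)
      cases b
      · simp [instrEdge, Guard.Sat, Rel.Holds, Config.val] at hl hg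
        exact (NetStep.get q a q' _ _ _ hi).of_eq
          (NetState.ext hl.symm hg.1.symm rfl rfl hg.2.symm rfl)
          (NetState.ext rfl rfl rfl rfl hg.2.symm rfl)
      · simp [instrEdge] at hop
    · have he' : e ∈ (List.range m).map readEdge ++ [periodEdge m] := he
      simp only [List.mem_append, List.mem_map, List.mem_range, List.mem_singleton] at he'
      rcases he' with ⟨a, ha, rfl⟩ | rfl
      · simp [readEdge] at hop
      · simp [periodEdge, Guard.Sat, Rel.Holds, Config.val] at hl hg
        exact (NetStep.period _ _ _ _).of_eq
          (NetState.ext rfl rfl hl.symm hg.symm rfl rfl)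
          (NetState.ext rfl rfl rfl rfl rfl rfl)
  | write i j a e he hop =>
    obtain ⟨he, hl, hg⟩ := he
    obtain rfl | rfl := fin_two_eq i
    · obtain ⟨⟨q, b, a', q'⟩, hi, rfl⟩ := List.mem_map.1 (show e ∈ P.map (instrEdge m) from he)
      cases b
      · simp [instrEdge] at hop
      · simp [instrEdge, Guard.Sat, Rel.Holds, Config.val] at hl hg hop
        obtain ⟨hj, rfl⟩ := hop
        obtain rfl : j = (1 : Fin 2) := Fin.ext hj.symm
        exact (NetStep.put q a' q' _ _ _ _ hi).of_eq
          (NetState.ext hl.symm hg.symm rfl rfl rfl rfl)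
          (NetState.ext rfl hg.symm rfl rfl rfl rfl)
    · have he' : e ∈ (List.range m).map readEdge ++ [periodEdge m] := he
      simp only [List.mem_append, List.mem_map, List.mem_range, List.mem_singleton] at he'
      rcases he' with ⟨a, ha, rfl⟩ | rfl
      · simp [readEdge] at hop
      · simp [periodEdge] at hop
  | read i j a I e w t he hop hc ht =>
    obtain ⟨he, hl, hg⟩ := he
    obtain rfl | rfl := fin_two_eq i
    · obtain ⟨⟨q, b, a', q'⟩, hi, rfl⟩ := List.mem_map.1 (show e ∈ P.map (instrEdge m) from he)
      cases b <;> simp [instrEdge] at hop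
    · have he' : e ∈ (List.range m).map readEdge ++ [periodEdge m] := he
      simp only [List.mem_append, List.mem_map, List.mem_range, List.mem_singleton] at he'
      rcases he' with ⟨a', ha, rfl⟩ | rfl
      · simp [readEdge, Guard.Sat, Rel.Holds, Config.val] at hl hg hop
        obtain ⟨hj, rfl, -⟩ := hop
        obtain rfl : j = (0 : Fin 2) := Fin.ext hj.symm
        exact (NetStep.receive _ _ a' _ _ ha).of_eq
          (NetState.ext rfl rfl hl.symm hg.symm rfl
            ((by simp : w.map Prod.fst ++ [a'] = (w ++ [(a', t)]).map Prod.fst).trans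
              (congrArg (List.map Prod.fst) hc.symm)))
          (NetState.ext rfl rfl rfl hg.symm rfl rfl)
      · simp [periodEdge] at hop

theorem step_of_netStep {γ : Config (network m P q₀).automata.length} {s : NetState}
    (h : NetStep m P (Config.netState γ) s) :
    ∃ γ', CTA.Step (network m P q₀) γ γ' ∧ Config.netState γ' = s := by
  generalize hs : Config.netState γ = s₀ at h
  cases h with
  | time q x r y g w t =>
    refine ⟨_, .time γ t, ?_⟩
    simp [Config.netState] at hs
    simp [Config.netState, Config.elapse, Function.comp_def, hs]
  | put q a q' r y g w h =>
    obtain ⟨hq, hx, hr, hy, hg, hw⟩ := NetState.ext_iff.1 hs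
    refine ⟨_, .write γ (0 : Fin 2) (1 : Fin 2) a (instrEdge m (q, true, a, q'))
      ⟨List.mem_map_of_mem h, hq, ?_⟩ rfl,
      NetState.ext rfl hx hr hy hg (congrArg (List.cons a) hw)⟩
    simpa [instrEdge, Guard.Sat, Rel.Holds, Config.val, Config.netState] using hx
  | get q a q' r y w h =>
    obtain ⟨hq, hx, hr, hy, hg, hw⟩ := NetState.ext_iff.1 hs
    refine ⟨_, .nop γ (0 : Fin 2) (instrEdge m (q, false, a, q'))
      ⟨List.mem_map_of_mem h, hq, ?_⟩ rfl,
      NetState.ext rfl rfl hr hy hg hw⟩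
    simpa [instrEdge, Guard.Sat, Rel.Holds, Config.val, Config.netState] using And.intro hx hg
  | receive q x a g w h =>
    obtain ⟨hq, hx, hr, hy, hg, hw⟩ := NetState.ext_iff.1 hs
    obtain ⟨w₁, w₂, hc, rfl, hw₂⟩ := List.map_eq_append_iff.1 hw
    obtain ⟨⟨b, t⟩, rfl, rfl⟩ := List.map_eq_singleton_iff.1 hw₂
    refine ⟨_, .read γ (1 : Fin 2) (0 : Fin 2) b _ (readEdge b) w₁ t
      ⟨?_, hr, ?_⟩ rfl hc ?_, NetState.ext hq hx rfl hy rfl rfl⟩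
    · exact List.mem_append_left _ (List.mem_map_of_mem (List.mem_range.2 h))
    · simpa [readEdge, Guard.Sat, Rel.Holds, Config.val, Config.netState] using hy
    · simp [AgeInterval.Mem]; omega
  | period q x g w =>
    obtain ⟨hq, hx, hr, hy, hg, hw⟩ := NetState.ext_iff.1 hs
    refine ⟨_, .nop γ (1 : Fin 2) (periodEdge m)
      ⟨List.mem_append_right _ (List.mem_singleton_self _), hr, ?_⟩ rfl,
      NetState.ext hq hx rfl rfl hg hw⟩
    simpa [periodEdge, Guard.Sat, Rel.Holds, Config.val, Config.netState] using hy

end CommTA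

/-! ### Correctness of the timing protocol. -/

namespace CommTA

open Relation

variable {m : ℕ} {P : List QInstr} {q₀ : ℕ}

/-- What holds in every reachable state of the network: the first automaton is in a location that
the queue machine can reach, and it is stuck, or the network is in one of the following phases: the
letter of this period is not read yet; it is read; only the first automaton has ended the period, at
this time or before; only the second automaton has ended the period. -/
def NetInv (m : ℕ) (P : List QInstr) (q₀ : ℕ) (s : NetState) : Prop :=
  QReach P q₀ s.q ∧
    (m + 1 < s.x ∨
      (s.y = s.x ∧ s.r = 0 ∧ s.x ≤ s.g ∧ ReflTransGen (QStep P) (q₀, []) (s.q, s.w)) ∨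
      (s.y = s.x ∧ s.r = 1 ∧ ∃ a < m, s.x = s.g + a + 1 ∧
        ReflTransGen (QStep P) (q₀, []) (s.q, s.w ++ [a])) ∨
      (s.x = 0 ∧ s.y = m + 1 ∧ s.r = 1 ∧ ReflTransGen (QStep P) (q₀, []) (s.q, s.w)) ∨
      (0 < s.x ∧ m + 1 < s.y ∧ s.x ≤ s.g) ∨
      (s.x = m + 1 ∧ s.y = 0 ∧ s.r = 0 ∧ ∃ a < m, s.x = s.g + a + 1 ∧
        ReflTransGen (QStep P) (q₀, []) (s.q, s.w ++ [a])))

/-- Letters leave the channel at times `a + 1 > 0` of a period, after all its writes, so a letter in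
transit to the control still counts as the last one of the queue. -/
theorem NetInv.netStep {s s' : NetState} (hP : ∀ i ∈ P, i.2.2.1 < m) (hs : NetInv m P q₀ s)
    (h : NetStep m P s s') : NetInv m P q₀ s' := by
  obtain ⟨hq, hs⟩ := hs
  cases h with
  | time q x r y g w t =>
    refine ⟨hq, ?_⟩
    simp only at hs ⊢
    by_cases ht : m + 1 < x + t
    · exact .inl ht
    rcases hs with h | ⟨h₁, h₂, h₃, h⟩ | ⟨h₁, h₂, a, ha, h₃, h⟩ | ⟨h₁, h₂, h₃, h⟩ |
      ⟨h₁, h₂, h₃⟩ | ⟨h₁, h₂, h₃, a, ha, h₄, h⟩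
    · omega
    · exact .inr (.inl ⟨by omega, h₂, by omega, h⟩)
    · exact .inr (.inr (.inl ⟨by omega, h₂, a, ha, by omega, h⟩))
    · rcases Nat.eq_zero_or_pos t with rfl | ht'
      · exact .inr (.inr (.inr (.inl ⟨h₁, h₂, h₃, h⟩)))
      -- The reader has missed the end of the period. It can never reset the global clock again, so
      -- the writer cannot pass its next read test.
      · exact .inr (.inr (.inr (.inr (.inl ⟨by omega, by omega, by omega⟩))))
    · exact .inr (.inr (.inr (.inr (.inl ⟨by omega, by omega, by omega⟩))))
    · obtain rfl : t = 0 := by omega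
      exact .inr (.inr (.inr (.inr (.inr ⟨h₁, h₂, h₃, a, ha, h₄, h⟩))))
  | put q a q' r y g w hi =>
    simp only at hs
    rcases hs with h | ⟨h₁, h₂, h₃, h⟩ | ⟨h₁, h₂, a, ha, h₃, h⟩ | ⟨h₁, h₂, h₃, h⟩ |
      ⟨h₁, h₂, h₃⟩ | ⟨h₁, h₂, h₃, a, ha, h₄, h⟩
    · omega
    · have h' := h.tail (.write q a q' w hi)
      exact ⟨⟨_, h'⟩, .inr (.inl ⟨h₁, h₂, h₃, h'⟩)⟩
    · omega
    · have h' := h.tail (.write q a q' w hi)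
      exact ⟨⟨_, h'⟩, .inr (.inr (.inr (.inl ⟨rfl, h₂, h₃, h'⟩)))⟩
    · omega
    · omega
  | get q a q' r y w hi =>
    have ham : a < m := hP _ hi
    simp only at hs
    rcases hs with h | ⟨h₁, h₂, h₃, h⟩ | ⟨h₁, h₂, b, hb, h₃, h⟩ | ⟨h₁, h₂, h₃, h⟩ |
      ⟨h₁, h₂, h₃⟩ | ⟨h₁, h₂, h₃, b, hb, h₄, h⟩
    · omega
    -- No letter was taken out: the global clock is at least `m + 1`, but the guard wants `m - a`.
    · omega
    -- The clock value determines the letter: `m + 1 = (m - a) + b + 1` with `a < m`.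
    · obtain rfl : a = b := by omega
      have h' := h.tail (.read q a q' w hi)
      exact ⟨⟨_, h'⟩, .inr (.inr (.inr (.inl ⟨rfl, h₁, h₂, h'⟩)))⟩
    · omega
    · omega
    · obtain rfl : a = b := by omega
      have h' := h.tail (.read q a q' w hi)
      exact ⟨⟨_, h'⟩, .inr (.inl ⟨h₂, h₃, Nat.zero_le _, h'⟩)⟩
  | receive q x a g w ha =>
    refine ⟨hq, ?_⟩
    simp only at hs ⊢
    rcases hs with h | ⟨h₁, h₂, h₃, h⟩ | ⟨h₁, h₂, h⟩ | ⟨h₁, h₂, h₃, h⟩ |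
      ⟨h₁, h₂, h₃⟩ | ⟨h₁, h₂, h₃, h⟩
    · exact .inl h
    · exact .inr (.inr (.inl ⟨h₁, trivial, a, ha, by omega, h⟩))
    all_goals omega
  | period q x g w =>
    refine ⟨hq, ?_⟩
    simp only at hs ⊢
    rcases hs with h | ⟨h₁, h₂, h₃, h⟩ | ⟨h₁, h₂, h⟩ | ⟨h₁, h₂, h₃, h⟩ |
      ⟨h₁, h₂, h₃⟩ | ⟨h₁, h₂, h₃, h⟩
    · exact .inl h
    · omega
    · exact .inr (.inr (.inr (.inr (.inr ⟨h₁.symm, trivial, trivial, h⟩))))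
    · exact .inr (.inl ⟨h₁.symm, trivial, by omega, h⟩)
    all_goals omega

/-- At the beginning of a period, the network can do what the queue machine does. -/
theorem netReaches_of_qStep (hP : ∀ i ∈ P, i.2.2.1 < m) {c c' : ℕ × List ℕ} (h : QStep P c c')
    (g : ℕ) : ∃ g', ReflTransGen (NetStep m P) ⟨c.1, 0, 0, 0, g, c.2⟩ ⟨c'.1, 0, 0, 0, g', c'.2⟩ := by
  cases h with
  | write q a q' w hi => exact ⟨g, .single (.put q a q' 0 0 g w hi)⟩
  | read q a q' w hi =>
    have ha : a < m := hP _ hi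
    -- Reset at time `a + 1`, the global clock runs for `m - a` more units until the period ends.
    refine ⟨m - a, ?_⟩
    have h₁ : NetStep m P ⟨q, 0, 0, 0, g, w ++ [a]⟩ ⟨q, a + 1, 0, a + 1, g + (a + 1), w ++ [a]⟩ := by
      simpa using NetStep.time (m := m) (P := P) q 0 0 0 g (w ++ [a]) (a + 1)
    have h₂ : NetStep m P ⟨q, a + 1, 1, a + 1, 0, w⟩ ⟨q, m + 1, 1, m + 1, m - a, w⟩ := by
      have := NetStep.time (m := m) (P := P) q (a + 1) 1 (a + 1) 0 w (m - a)
      rwa [show a + 1 + (m - a) = m + 1 by omega, Nat.zero_add] at this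
    exact ((((ReflTransGen.single h₁).tail (.receive q _ a _ w ha)).tail h₂).tail
      (.get q a q' _ _ w hi)).tail (.period q' 0 _ w)

theorem network_locReachable_iff (hP : ∀ i ∈ P, i.2.2.1 < m) (q : ℕ) :
    (network m P q₀).LocReachable 0 q ↔ QReach P q₀ q := by
  constructor
  · rintro ⟨γ₀, γ, ⟨hl, hc, hg, hw⟩, hr, i, hi, hq⟩
    have h₀ : Config.netState γ₀ = ⟨q₀, 0, 0, 0, 0, []⟩ :=
      NetState.ext (List.mem_singleton.1 (hl (0 : Fin 2))) (hc _ _)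
        (List.mem_singleton.1 (hl (1 : Fin 2))) (hc _ _) (hg _)
        (congrArg (List.map Prod.fst) (hw (0 : Fin 2) (1 : Fin 2)))
    have hinv : NetInv m P q₀ (Config.netState γ) := by
      clear hq
      induction hr with
      | refl =>
        rw [h₀]
        exact ⟨⟨_, .refl⟩, .inr (.inl ⟨rfl, rfl, le_rfl, .refl⟩)⟩
      | tail _ hs ih => exact ih.netStep hP (netStep_of_step hs)
    obtain rfl : i = (0 : Fin 2) := Fin.ext hi
    have h := hinv.1
    rwa [show (Config.netState γ).q = q from hq] at h
  · rintro ⟨w, hw⟩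
    let γ₀ : Config (network m P q₀).automata.length :=
      { loc := ![q₀, 0], clk := fun _ _ => 0, glob := fun _ => 0, chan := fun _ _ => [] }
    have hr : ∀ {c : ℕ × List ℕ}, ReflTransGen (QStep P) (q₀, []) c →
        ∃ g, ReflTransGen (NetStep m P) ⟨q₀, 0, 0, 0, 0, []⟩ ⟨c.1, 0, 0, 0, g, c.2⟩ := by
      intro c hc
      induction hc with
      | refl => exact ⟨0, .refl⟩
      | tail _ hs ih =>
        obtain ⟨g, hg⟩ := ih
        obtain ⟨g', hg'⟩ := netReaches_of_qStep hP hs g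
        exact ⟨g', hg.trans hg'⟩
    have hlift : ∀ {s : NetState}, ReflTransGen (NetStep m P) ⟨q₀, 0, 0, 0, 0, []⟩ s →
        ∃ γ, ReflTransGen (network m P q₀).Step γ₀ γ ∧ Config.netState γ = s := by
      intro s hs
      induction hs with
      | refl => exact ⟨γ₀, .refl, rfl⟩
      | tail _ hs ih =>
        obtain ⟨γ, hγ, rfl⟩ := ih
        obtain ⟨γ', hγ', rfl⟩ := step_of_netStep hs
        exact ⟨γ', hγ.tail hγ', rfl⟩
    obtain ⟨g, hg⟩ := hr hw
    obtain ⟨γ, hγ, hs⟩ := hlift hg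
    refine ⟨γ₀, γ, ⟨fun i => ?_, fun _ _ => rfl, fun _ => rfl, fun _ _ => rfl⟩, hγ, (0 : Fin 2),
      rfl, congrArg NetState.q hs⟩
    obtain rfl | rfl := fin_two_eq i
    · exact List.mem_singleton_self q₀
    · exact List.mem_singleton_self 0

/-! ### Computability of the reduction. -/

theorem primrec_atom {α : Type} [Primcodable α] {f : α → Clock} {g : α → Rel} {h : α → ℕ}
    (hf : Primrec f) (hg : Primrec g) (hh : Primrec h) : Primrec fun a => Atom.mk (f a) (g a) (h a) :=
  (Primrec.of_equiv_iff Atom.equivProd).1 (hf.pair (hg.pair hh))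

theorem primrec_edge {α : Type} [Primcodable α] {f : α → ℕ} {g : α → Guard} {o : α → ChanOp}
    {Y : α → List Clock} {f' : α → ℕ} (hf : Primrec f) (hg : Primrec g) (ho : Primrec o)
    (hY : Primrec Y) (hf' : Primrec f') :
    Primrec fun a => Edge.mk (f a) (g a) (o a) (Y a) (f' a) :=
  (Primrec.of_equiv_iff Edge.equivProd).1 (hf.pair (hg.pair (ho.pair (hY.pair hf'))))

theorem primrec_write {α : Type} [Primcodable α] {f g : α → ℕ} (hf : Primrec f) (hg : Primrec g) :
    Primrec fun a => ChanOp.write (f a) (g a) :=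
  (Primrec.of_equiv_iff ChanOp.equivSum).1
    (Primrec.sumInr.comp (Primrec.sumInl.comp (hf.pair hg)))

theorem primrec_instrEdge (m : ℕ) : Primrec (instrEdge m) := by
  have h₁ : Primrec fun i : QInstr => i.2.1 := Primrec.fst.comp Primrec.snd
  have h₂ : Primrec fun i : QInstr => i.2.2.1 :=
    Primrec.fst.comp (Primrec.snd.comp Primrec.snd)
  have h₃ : Primrec fun i : QInstr => i.2.2.2 :=
    Primrec.snd.comp (Primrec.snd.comp Primrec.snd)
  refine Primrec.ite (Primrec.eq.comp h₁ (Primrec.const true)) ?_ ?_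
  · exact primrec_edge Primrec.fst (Primrec.const _) (primrec_write (Primrec.const 1) h₂)
      (Primrec.const _) h₃
  · exact primrec_edge Primrec.fst (Primrec.list_cons.comp (Primrec.const _)
      (Primrec.list_cons.comp (primrec_atom (Primrec.const _) (Primrec.const _)
        (Primrec.nat_sub.comp (Primrec.const m) h₂)) (Primrec.const [])))
      (Primrec.const _) (Primrec.const _) h₃

theorem primrec_locBound : Primrec locBound := by
  refine Primrec.list_foldr (h := fun _ (p : QInstr × ℕ) => p.1.1 + p.1.2.2.2 + p.2)
    Primrec.id (Primrec.const 1) ?_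
  have h : Primrec fun x : List QInstr × QInstr × ℕ => x.2.1 := Primrec.fst.comp Primrec.snd
  exact Primrec.nat_add.comp (Primrec.nat_add.comp (Primrec.fst.comp h)
    (Primrec.snd.comp (Primrec.snd.comp (Primrec.snd.comp h)))) (Primrec.snd.comp Primrec.snd)

theorem primrec_writerTA (m : ℕ) :
    Primrec fun p : List QInstr × ℕ => writerTA m p.1 p.2 := by
  refine (Primrec.of_equiv_iff TA.equivProd).1 ?_
  exact (Primrec.nat_add.comp Primrec.snd (primrec_locBound.comp Primrec.fst)).pair
    ((Primrec.list_cons.comp Primrec.snd (Primrec.const [])).pair ((Primrec.const 1).pair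
      ((Primrec.list_map Primrec.fst ((primrec_instrEdge m).comp Primrec.snd).to₂).pair
        (Primrec.const []))))

theorem primrec_network (m : ℕ) :
    Primrec fun p : List QInstr × ℕ => network m p.1 p.2 := by
  refine (Primrec.of_equiv_iff CTA.equivProd).1 ?_
  exact (Primrec.list_cons.comp (primrec_writerTA m) (Primrec.const [readerTA m])).pair
    (Primrec.const (1, m, [(0, 1)]))

end CommTA

theorem corollary1 :
    CommTA.UndecidableOn
      (fun p : CommTA.ReachInstance =>
        p.Valid ∧ p.1.automata.length = 2 ∧ p.1.channels = [(0, 1)] ∧ p.1.numGlobals = 1)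
      CommTA.Reachability := by
  rintro ⟨D, hD, h⟩
  obtain ⟨m, P, q₀, hP, hq₀, hm, hu⟩ := CommTA.exists_program_not_computablePred
  -- The question concerns the writer, automaton `0`, and the halting location `0` of the queue
  -- machine.
  have hf : Computable fun n => ((CommTA.network m (P n) (q₀ n), 0, 0) : CommTA.ReachInstance) :=
    ((CommTA.primrec_network m).to_comp.comp (hP.pair hq₀)).pair (Computable.const (0, 0))
  refine hu ?_
  obtain ⟨d, hd, e⟩ := ComputablePred.computable_iff.1 hD
  refine ComputablePred.computable_iff.2 ⟨fun n => d (CommTA.network m (P n) (q₀ n), 0, 0),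
    hd.comp hf, funext fun n => ?_⟩
  rw [← congrFun e, ← CommTA.network_locReachable_iff (hm n)]
  have hl : 0 < q₀ n + CommTA.locBound (P n) := by
    have := CommTA.one_le_locBound (P := P n)
    omega
  have hv : CommTA.ReachInstance.Valid (CommTA.network m (P n) (q₀ n), 0, 0) :=
    ⟨CommTA.network_wellFormed (hm n), (0 : Fin 2), rfl, hl⟩
  exact propext (h (CommTA.network m (P n) (q₀ n), 0, 0) ⟨hv, rfl, rfl, rfl⟩).symm
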